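/- For a set (alphabet) $\Sigma$, finite or infinite, let $\Sigma^+$ be the free semigroup on $\Sigma$, that is, the set of nonempty words over $\Sigma$ under concatenation. For $w\in\Sigma^+$ and $k\ge 0$ let $i_k(w)$ and $t_k(w)$ be the prefix and the suffix of $w$ of length $k$, or $w$ itself if $|w|<k$; for $k\ge 1$ let $F_k(w)$ be the set of all words $x$ with $|x|=k$ and $w=uxv$ for some possibly empty words $u,v$ over $\Sigma$. For $n\ge 1$ let $B_n$ be the class of all semigroups $S$ (finite or infinite) for which there are an alphabet $\Sigma$ and a surjective homomorphism $\varphi:\Sigma^+\to S$ such that for all $u,v\in\Sigma^+$, if $i_{n-1}(u)=i_{n-1}(v)$, $t_{n-1}(u)=t_{n-1}(v)$ and $F_n(u)=F_n(v)$, then $\varphi(u)=\varphi(v)$. **Theorem 3.3.** (a) For every $n\ge 1$, $B_n$ is a variety of semigroups, i.e. it is closed under homomorphic images, subsemigroups and arbitrary direct products. (b) For every $n\ge 2$, the following identities form a basis of identities for $B_n$, i.e. a semigroup belongs to $B_n$ if and only if it satisfies all of them: $$\alpha_r:\quad (x_1\cdots x_r)^{m+1}x_1\cdots x_p=(x_1\cdots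 x_r)^{m+2}x_1\cdots x_p\qquad (r=1,\dots,n),$$ where $p\in\{0,\dots,r-1\}$ is the residue of $n-1$ modulo $r$ and $m=(n-p-1)/r$ (for $p=0$ the factor $x_1\cdots x_p$ is absent), together with $$x_1\cdots x_{n-1}\,y\,x_1\cdots x_{n-1}\,z\,x_1\cdots x_{n-1}=x_1\cdots x_{n-1}\,z\,x_1\cdots x_{n-1}\,y\,x_1\cdots x_{n-1}.$$ (c) $B_1$ is the class of all semigroups satisfying the identities $x^2=x$ and $xy=yx$. -/

import Mathlib

universe u

namespace TestableSemigroup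

/-! ### Words, prefixes, suffixes, factors -/

/-- The nonempty list of letters of a word `w ∈ Σ⁺`. -/
def letters {A : Type u} (w : FreeSemigroup A) : List A := w.head :: w.tail

/-- The prefix of length `k` of `w`, or `w` itself if `|w| < k`. -/
def prefixOf {A : Type u} (k : ℕ) (w : FreeSemigroup A) : List A := (letters w).take k

/-- The suffix of length `k` of `w`, or `w` itself if `|w| < k`. -/
def suffixOf {A : Type u} (k : ℕ) (w : FreeSemigroup A) : List A :=
  (letters w).drop ((letters w).length - k)

/-- The set of factors (blocks of consecutive letters) of length `k` of `w`. The words before and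
after the factor may be empty. -/
def factors {A : Type u} (k : ℕ) (w : FreeSemigroup A) : Set (List A) :=
  {x | x.length = k ∧ ∃ s t : List A, letters w = s ++ x ++ t}

/-- `S` is `n`-testable (with prefixes and suffixes of length `n - 1` and factors of length `n`).
Meaningful for `n ≥ 1`. The alphabet may be infinite, and so may `S`. -/
def IsTestable (n : ℕ) (S : Type u) [Semigroup S] : Prop :=
  ∃ (A : Type u) (φ : FreeSemigroup A →ₙ* S), Function.Surjective φ ∧
    ∀ v w : FreeSemigroup A,
      prefixOf (n - 1) v = prefixOf (n - 1) w →
      suffixOf (n - 1) v = suffixOf (n - 1) w →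
      factors n v = factors n w →
      φ v = φ w

/-! ### Varieties -/

/-- A class of semigroups. -/
abbrev SemigroupClass := ∀ (S : Type u) [Semigroup S], Prop

/-- The class `B n` of `n`-testable semigroups. -/
def B (n : ℕ) : SemigroupClass.{u} := fun S _ => IsTestable n S

/-- A variety of semigroups: a class closed under homomorphic images, subsemigroups and arbitrary
direct products (the empty product being the one-element semigroup). -/
structure IsVariety (C : SemigroupClass.{u}) : Prop where
  image : ∀ (S T : Type u) [Semigroup S] [Semigroup T] (f : S →ₙ* T),
    Function.Surjective f → C S → C T
  sub : ∀ (S : Type u) [Semigroup S] (T : Subsemigroup S), C S → C T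
  prod : ∀ (ι : Type u) (S : ι → Type u) [∀ i, Semigroup (S i)],
    (∀ i, C (S i)) → C (∀ i, S i)

/-! ### Identities -/

/-- The variables `x₁, x₂, …`, `y`, `z`. -/
inductive Var : Type
  | x (i : ℕ) : Var
  | y : Var
  | z : Var

/-- An identity `e.1 = e.2`. All identities below have nonempty words as sides. -/
abbrev Identity := FreeMonoid Var × FreeMonoid Var

/-- The value of a word under a substitution of elements of `S` for the variables, computed in
`S` with an identity element adjoined; see `eval_toFreeMonoid` for nonempty words. -/
def eval {S : Type u} [Semigroup S] (f : Var → S) : FreeMonoid Var →* WithOne S :=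
  FreeMonoid.lift fun v => (f v : WithOne S)

/-- The value of a nonempty word is its usual value in `S`. -/
theorem eval_toFreeMonoid {S : Type u} [Semigroup S] (f : Var → S) (w : FreeSemigroup Var) :
    eval f (FreeSemigroup.toFreeMonoid w) = ((FreeSemigroup.lift f w : S) : WithOne S) := by
  induction w using FreeSemigroup.recOnMul with
  | ih1 v => simp [eval]
  | ih2 v w hv hw => rw [map_mul, map_mul, map_mul, WithOne.coe_mul, hw, ← hv]

/-- The identity `e` holds in `S`: both sides agree under every substitution of elements of `S`
for the variables. -/
def Holds (S : Type u) [Semigroup S] (e : Identity) : Prop :=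
  ∀ f : Var → S, eval f e.1 = eval f e.2

/-- `C` is the class of all semigroups that satisfy all identities of `I`, that is, `I` is a basis
of identities for `C`. -/
def IsBasisOfIdentities (I : Set Identity) (C : SemigroupClass.{u}) : Prop :=
  ∀ (S : Type u) [Semigroup S], C S ↔ ∀ e ∈ I, Holds S e

/-- The word `x₁ x₂ ⋯ x_l`. -/
def X (l : ℕ) : FreeMonoid Var := FreeMonoid.ofList ((List.range l).map fun i => Var.x (i + 1))

/-- The word `y`. -/
def Y : FreeMonoid Var := FreeMonoid.of Var.y

/-- The word `z`. -/
def Z : FreeMonoid Var := FreeMonoid.of Var.z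

/-- `(x₁ ⋯ x_r)^(m+1) x₁ ⋯ x_p = (x₁ ⋯ x_r)^(m+2) x₁ ⋯ x_p`, where `p` is the residue of `n - 1`
modulo `r` and `m = (n - p - 1) / r` (an exact division). -/
def alpha (n r : ℕ) : Identity :=
  let p := (n - 1) % r
  let m := (n - p - 1) / r
  (X r ^ (m + 1) * X p, X r ^ (m + 2) * X p)

/-- `X y X z X = X z X y X`, where `X = x₁ ⋯ x_{n-1}`. -/
def beta (n : ℕ) : Identity :=
  (X (n - 1) * Y * X (n - 1) * Z * X (n - 1), X (n - 1) * Z * X (n - 1) * Y * X (n - 1))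

/-- The identities `alpha n r` for `1 ≤ r ≤ n` together with `beta n`. -/
def basis (n : ℕ) : Set Identity :=
  {e | ∃ r, 1 ≤ r ∧ r ≤ n ∧ e = alpha n r} ∪ {beta n}

/-- The identities `x² = x` and `xy = yx`, with `y, z` as the two variables. -/
def semilatticeIdentities : Set Identity := {(Y ^ 2, Y), (Y * Z, Z * Y)}

end TestableSemigroup

/-!
Put `k = n - 1`. A word of length at least `k` is a path in the de Bruijn graph, whose vertices are
the words of length `k` and whose edges are the words of length `k + 1 = n`: the path starts at the
prefix of length `k`, ends at the suffix of length `k`, and traverses exactly the factors of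
length `n`. So `n`-testability says that the value of a word is determined by the two ends of its
path and the set of edges of the path.

*The identities suffice.* A loop at the vertex `v` is a word `l` with `v l = g v` for some `g`.
If `|l| ≤ n`, then `v l` has the period `|l|`, so that `alpha n |l|` gives `v l l = v l`; if
`|l| > n`, then `v l = v y v` with `y` nonempty, and `alpha n n` gives the same. Repeating
a loop makes it long, so that every nonempty loop satisfies `v l = v y v` in the semigroup, and then
`beta n` says that any two loops at `v` commute (`wprod_loop_idem`, `wprod_loop_comm`). By Simon's
theorem on graph congruences (`LoopSemilattice.val_eq`), coterminal paths with the same edges have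
the same value as soon as loops are idempotent and commute.

*The identities are necessary.* If `k ≤ |T|`, a factor of `a T b` of length `n` lies in `a T` or
in `T b`; hence the sides of each identity, with words substituted for the variables, have the same
prefixes, suffixes and factors (`sameTests_loop`, `sameTests_swap`).

All of this works for `n = 1` as well, where the graph has one vertex and the basis amounts to
`x² = x`, `xy = yx`. Closure under images, subsemigroups and products then holds as for any
class defined by identities.
-/

namespace TestableSemigroup

/-! ### Paths in a deterministic automaton -/

section Automaton

variable {Q A M : Type*} (step : Q → A → Q)

/-- The list of edges traversed by the path that starts in the state `q` and reads `w`. An edge is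
recorded as a pair (source state, letter); this determines its target. -/
def edges : Q → List A → List (Q × A)
  | _, [] => []
  | q, a :: w => (q, a) :: edges (step q a) w

theorem edges_append (q : Q) (u v : List A) :
    edges step q (u ++ v) = edges step q u ++ edges step (u.foldl step q) v := by
  induction u generalizing q with
  | nil => rfl
  | cons a u ih => simp [edges, ih]

theorem edges_cons (q : Q) (a : A) (w : List A) :
    edges step q (a :: w) = (q, a) :: edges step (step q a) w := rfl

theorem edges_nil (q : Q) : edges step q [] = [] := rfl

theorem exists_eq_append_of_mem_edges {q p : Q} {a : A} {w : List A}
    (h : (p, a) ∈ edges step q w) : ∃ u v, w = u ++ a :: v ∧ u.foldl step q = p := by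
  induction w generalizing q with
  | nil => simp [edges] at h
  | cons b w ih =>
    rcases List.mem_cons.1 h with h | h
    · obtain ⟨rfl, rfl⟩ := Prod.mk.inj h
      exact ⟨[], w, rfl, rfl⟩
    · obtain ⟨u, v, rfl, hu⟩ := ih h
      exact ⟨b :: u, v, rfl, hu⟩

/-- A path that leaves a set `s` of edges splits at the first edge outside `s`. -/
theorem exists_first_edge_notMem {s : Set (Q × A)} {q : Q} {w : List A}
    (h : ¬ ∀ e ∈ edges step q w, e ∈ s) :
    ∃ u a v, w = u ++ a :: v ∧ (∀ e ∈ edges step q u, e ∈ s) ∧ (u.foldl step q, a) ∉ s := by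
  induction w generalizing q with
  | nil => simp [edges] at h
  | cons b w ih =>
    by_cases hb : (q, b) ∈ s
    · obtain ⟨u, a, v, rfl, h1, h2⟩ := ih (q := step q b) fun h' => h fun e he => by
        rcases List.mem_cons.1 he with rfl | he
        exacts [hb, h' e he]
      refine ⟨b :: u, a, v, rfl, fun e he => ?_, h2⟩
      rcases List.mem_cons.1 he with rfl | he
      exacts [hb, h1 e he]
    · exact ⟨[], b, w, rfl, by simp [edges], hb⟩

/-- A function `val` on the paths from `q` is *loop-semilattice* if, at any point of a path, a loop
may be repeated and two consecutive loops may be exchanged without changing the value. -/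
structure LoopSemilattice (q : Q) (val : List A → M) : Prop where
  idem : ∀ w l r, (w ++ l).foldl step q = w.foldl step q →
    val (w ++ (l ++ (l ++ r))) = val (w ++ (l ++ r))
  comm : ∀ w l l' r, (w ++ l).foldl step q = w.foldl step q →
    (w ++ l').foldl step q = w.foldl step q →
    val (w ++ (l ++ (l' ++ r))) = val (w ++ (l' ++ (l ++ r)))

namespace LoopSemilattice

variable {step} {q : Q} {val : List A → M}

/-- A path `l` over edges that `w` has already traversed can be inserted after `w`, together with
some way `z` back. -/
theorem exists_return (h : LoopSemilattice step q val) (w l : List A)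
    (hl : edges step (w.foldl step q) l ⊆ edges step q w) :
    ∃ z, (w ++ l ++ z).foldl step q = w.foldl step q ∧
      edges step ((w ++ l).foldl step q) z ⊆ edges step q w ∧
      ∀ r, val (w ++ (l ++ (z ++ r))) = val (w ++ r) := by
  induction l using List.reverseRecOn with
  | nil => exact ⟨[], by simp [edges]⟩
  | append_singleton l a ih =>
    rw [edges_append, List.append_subset] at hl
    obtain ⟨z, hz, hzE, hzv⟩ := ih hl.1
    obtain ⟨u, v, hw, hu⟩ := exists_eq_append_of_mem_edges step (hl.2 (by simp [edges] :
      (l.foldl step (w.foldl step q), a) ∈ _))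
    -- `w ++ l` ends with the loop `a :: v ++ l`, which is repeated to make room for `a`
    have hloop : (u ++ (a :: v ++ l)).foldl step q = u.foldl step q := by
      rw [hu, ← List.foldl_append, hw]; simp
    have hw' : w.foldl step q = v.foldl step (step (l.foldl step (w.foldl step q)) a) := by
      conv_lhs => rw [hw]
      rw [← hu]; simp
    refine ⟨v ++ l ++ z, ?_, ?_, fun r => ?_⟩
    · rw [← hz]
      simp only [List.foldl_append, List.foldl_cons, List.foldl_nil]
      rw [← hw']
    · have hv : edges step (step (u.foldl step q) a) v ⊆ edges step q w := by
        rw [hw, edges_append, edges_cons]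
        intro e he; simp [he]
      rw [hu] at hv
      simp only [List.foldl_append, List.foldl_cons, List.foldl_nil] at hzE ⊢
      simp only [edges_append, List.append_subset, List.foldl_append, ← hw']
      exact ⟨⟨hv, hl.1⟩, hzE⟩
    · have := h.idem u (a :: v ++ l) (z ++ r) hloop
      rw [← hzv r]
      conv_lhs => rw [hw]
      conv_rhs => rw [hw]
      simpa using this

/-- A loop over edges that have already been traversed can be dropped. -/
theorem val_absorb (h : LoopSemilattice step q val) {w l : List A} (r : List A)
    (hloop : (w ++ l).foldl step q = w.foldl step q)
    (hl : edges step (w.foldl step q) l ⊆ edges step q w) :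
    val (w ++ (l ++ r)) = val (w ++ r) := by
  obtain ⟨z, hz, -, hzv⟩ := h.exists_return w l hl
  have hz' : (w ++ z).foldl step q = w.foldl step q := by
    rw [List.foldl_append, hloop] at hz
    rw [List.foldl_append, hz]
  rw [← hzv (l ++ r), ← hzv r]
  have h1 := h.comm (w ++ l) z l r (by rw [hz, hloop])
    (by rw [List.foldl_append, hloop, ← List.foldl_append, hloop])
  simp only [List.append_assoc] at h1
  rw [h1, h.idem w l _ hloop]

open Classical in
/-- A loop can be inserted at any point of a path that traverses all its edges, be it before or
after that point. -/
theorem val_insert (h : LoopSemilattice step q val) (w l r : List A)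
    (hloop : (w ++ l).foldl step q = w.foldl step q)
    (hl : edges step (w.foldl step q) l ⊆ edges step q (w ++ r)) :
    val (w ++ (l ++ r)) = val (w ++ r) := by
  -- induction on the number of edges of the loop not yet traversed by `w`
  induction hN : ((edges step (w.foldl step q) l).toFinset \ (edges step q w).toFinset).card
    using Nat.strong_induction_on generalizing w l r with
  | _ N ih =>
  by_cases hall : ∀ e ∈ edges step (w.foldl step q) l, e ∈ {e | e ∈ edges step q w}
  · exact h.val_absorb r hloop hall
  obtain ⟨m, a, m', rfl, hm, ha⟩ := exists_first_edge_notMem step hall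
  have har : (m.foldl step (w.foldl step q), a) ∈ edges step (w.foldl step q) r := by
    have : (m.foldl step (w.foldl step q), a) ∈ edges step q (w ++ r) :=
      hl (by simp [edges_append, edges_cons])
    rw [edges_append, List.mem_append] at this
    exact this.resolve_left ha
  obtain ⟨u, v, rfl, hu⟩ := exists_eq_append_of_mem_edges step har
  obtain ⟨z, hz, hzE, hzv⟩ := h.exists_return w m hm
  -- move to the path that runs to the missing edge `a`, with the loop rotated so as to end in `a`
  simp only [List.foldl_append, List.foldl_cons] at hloop hz hu hzE
  have key := ih _ ?_ (w ++ m ++ z ++ u ++ [a]) (m' ++ m ++ [a]) v ?_ ?_ rfl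
  · have c1 := h.comm (w ++ m) (z ++ u) (a :: m' ++ m) (a :: v)
      (by simp [hz, hu]) (by simp [hloop])
    have c2 := h.comm w (m ++ a :: m') (m ++ z) (u ++ a :: v)
      (by simp [hloop]) (by simp [hz])
    have e1 := hzv (u ++ a :: v)
    have e2 := hzv (m ++ a :: m' ++ (u ++ a :: v))
    simp only [List.append_assoc, List.cons_append, List.nil_append] at *
    rw [← e2, ← c2, ← c1, key, e1]
  · rw [← hN]
    simp only [List.foldl_append, List.foldl_cons, List.foldl_nil, hz, hu]
    apply Finset.card_lt_card
    rw [Finset.ssubset_iff_of_subset]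
    · refine ⟨(m.foldl step (w.foldl step q), a), ?_, ?_⟩
      · simp only [Finset.mem_sdiff, List.mem_toFinset]
        exact ⟨by simp [edges_append, edges_cons], ha⟩
      · simp [edges_append, edges_cons, hz, hu]
    · intro e
      simp only [Finset.mem_sdiff, List.mem_toFinset, edges_append, edges_cons, edges_nil,
        List.foldl_append, List.mem_append, List.mem_cons, hz, hu, hloop]
      tauto
  · simp [hz, hu, hloop]
  · intro e he
    have := @hl e
    simp only [edges_append, edges_cons, edges_nil,
        List.foldl_append, List.foldl_cons, List.foldl_nil, List.mem_append, List.mem_cons,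
        hz, hu, hloop] at this he ⊢
    tauto

/-- **Simon's theorem on graph congruences**, for a deterministic automaton: the value of a path
depends only on its end and on the set of its edges. -/
theorem val_eq (h : LoopSemilattice step q val) {s t : List A}
    (hend : s.foldl step q = t.foldl step q)
    (hE : ∀ e, e ∈ edges step q s ↔ e ∈ edges step q t) : val s = val t := by
  -- `s` is changed, prefix by prefix, into a path that begins with `t`
  have key : ∀ y y', t = y ++ y' → ∃ z, val s = val (y ++ z) ∧
      (y ++ z).foldl step q = t.foldl step q ∧
      ∀ e, e ∈ edges step q (y ++ z) ↔ e ∈ edges step q t := by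
    intro y
    induction y using List.reverseRecOn with
    | nil => exact fun _ _ => ⟨s, rfl, hend, hE⟩
    | append_singleton y a ih =>
      intro y' ht
      obtain ⟨z, hv, hzend, hzE⟩ := ih (a :: y') (by simp [ht])
      set c := y.foldl step q with hc
      have htE : ∀ e, e ∈ edges step q t ↔
          e ∈ edges step q y ∨ e = (c, a) ∨ e ∈ edges step (step c a) y' := by
        intro e
        simp [ht, edges_append, edges_cons, ← hc]
      by_cases hf : ∃ f, f.foldl step (step c a) = c ∧
          edges step (step c a) f ⊆ edges step q t
      · -- the edge `a` lies on a loop `a :: f`, which can be inserted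
        obtain ⟨f, hfc, hfE⟩ := hf
        refine ⟨f ++ z, ?_, ?_, fun e => ?_⟩
        · rw [hv, ← h.val_insert y (a :: f) z (by simp [← hc, hfc])]
          · simp
          · intro e he
            rw [hzE]
            rw [← hc, edges_cons, List.mem_cons] at he
            rcases he with rfl | he
            exacts [(htE _).2 (by simp), hfE he]
        · rw [← hzend]; simp [← hc, hfc]
        · have := @hfE e
          rw [← hzE, edges_append] at this ⊢
          have h2 := (hzE (c, a)).2 ((htE _).2 (by simp))
          simp only [edges_append, edges_cons, edges_nil, List.foldl_append, List.foldl_cons,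
            List.foldl_nil, List.mem_append, List.mem_cons, List.not_mem_nil, or_false,
            ← hc, hfc] at this h2 ⊢
          constructor
          · rintro ((he | rfl) | he | he) <;> tauto
          · tauto
      · -- the edge `a` leaves a strong component; what `z` does before it was done by `y` already
        have hay : (c, a) ∉ edges step q y := by
          intro hm
          obtain ⟨u, v, hy, hu⟩ := exists_eq_append_of_mem_edges step hm
          have hva : v.foldl step (step c a) = c := by
            have := hc.symm
            rw [hy] at this
            simpa [hu] using this
          refine hf ⟨v, hva, fun e he => (htE e).2 (.inl ?_)⟩
          rw [hy, edges_append, edges_cons, hu]; simp [he]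
        have haz : (c, a) ∈ edges step c z := by
          have := (hzE (c, a)).2 ((htE _).2 (by simp))
          rw [edges_append, List.mem_append] at this
          exact this.resolve_left hay
        obtain ⟨u, v, rfl, hu⟩ := exists_eq_append_of_mem_edges step haz
        have huE : edges step c u ⊆ edges step q y := by
          rintro ⟨p, b⟩ hg
          obtain ⟨g, g', rfl, hgp⟩ := exists_eq_append_of_mem_edges step hg
          have hg' : edges step (step p b) g' ⊆ edges step q t := fun e he => by
            rw [← hzE, edges_append]
            simp only [List.mem_append, edges_append, edges_cons, ← hc, hgp, List.mem_cons]
            tauto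
          have hgc : g'.foldl step (step p b) = c := by
            rw [← hgp]; simpa using hu
          have hpb : (p, b) ∈ edges step q t := by
            rw [← hzE, edges_append]
            simp only [List.mem_append, edges_append, edges_cons, ← hc, hgp, List.mem_cons]
            tauto
          rcases (htE _).1 hpb with h1 | h1 | h1
          · exact h1
          · obtain ⟨rfl, rfl⟩ := Prod.mk.inj h1
            exact absurd ⟨g', hgc, hg'⟩ hf
          · obtain ⟨k, k', rfl, hk⟩ := exists_eq_append_of_mem_edges step h1
            refine absurd ⟨k ++ b :: g', by simp [hk, hgc], fun e he => ?_⟩ hf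
            rw [edges_append, edges_cons, hk, List.mem_append, List.mem_cons] at he
            rcases he with he | rfl | he
            · refine (htE e).2 (.inr (.inr ?_))
              rw [edges_append]; simp [he]
            · exact hpb
            · exact hg' he
        refine ⟨v, ?_, ?_, fun e => ?_⟩
        · rw [hv, h.val_absorb (a :: v) (by simp [← hc, hu]) huE]; simp
        · rw [← hzend]; simp [← hc, hu]
        · have := @huE e
          rw [← hzE]
          simp only [edges_append, edges_cons, edges_nil, List.foldl_append, List.foldl_cons,
            List.foldl_nil, List.mem_append, List.mem_cons, List.not_mem_nil, or_false,
            ← hc, hu] at this ⊢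
          tauto
  obtain ⟨z, hv, hzend, hzE⟩ := key t [] (by simp)
  have := h.val_absorb (w := t) (l := z) [] hzend fun e he => (hzE e).1 (by
    rw [edges_append]; simp [he])
  simpa [hv] using this

end LoopSemilattice

end Automaton

/-! ### Words as paths in a de Bruijn graph -/

section DeBruijn

variable {A : Type*}

/-- The transition of the de Bruijn graph: append a letter and drop the first one. The states of
interest are the words of a fixed length `k`; that length is preserved, also for `k = 0`. -/
def shift (q : List A) (a : A) : List A := (q ++ [a]).tail

theorem length_shift (q : List A) (a : A) : (shift q a).length = q.length := by simp [shift]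

theorem foldl_shift (q t : List A) : t.foldl shift q = (q ++ t).drop t.length := by
  induction t generalizing q with
  | nil => simp
  | cons a t ih =>
    rw [List.foldl_cons, ih, shift, List.append_cons, ← List.tail_append_of_ne_nil (by simp)]
    simp

theorem length_foldl_shift (q t : List A) : (t.foldl shift q).length = q.length := by
  simp [foldl_shift]

theorem append_eq_append_foldl_shift (q t : List A) :
    ∃ g, q ++ t = g ++ t.foldl shift q :=
  ⟨_, by rw [foldl_shift, List.take_append_drop t.length]⟩

/-- The edges of the path that reads `t` from `q` are the factors of `q ++ t` of length
`q.length + 1`. -/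
theorem mem_edges_shift {q t p : List A} {a : A} :
    (p, a) ∈ edges shift q t ↔ p.length = q.length ∧ p ++ [a] <:+: q ++ t := by
  induction t generalizing q with
  | nil =>
    simp only [edges_nil, List.not_mem_nil, List.append_nil, false_iff, not_and]
    intro h h'
    have := h'.length_le
    simp at this
    omega
  | cons b t ih =>
    rw [edges_cons, List.mem_cons, ih, length_shift]
    obtain ⟨c, q', hq⟩ : ∃ c q', q ++ [b] = c :: q' := List.exists_cons_of_ne_nil (by simp)
    have hs : shift q b = q' := by simp [shift, hq]
    rw [hs, List.append_cons q, hq, List.cons_append, List.infix_cons_iff, ← List.cons_append, ← hq]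
    constructor
    · rintro (h | ⟨h1, h2⟩)
      · obtain ⟨rfl, rfl⟩ := Prod.mk.inj h
        exact ⟨rfl, .inl (List.prefix_append _ _)⟩
      · exact ⟨h1, .inr h2⟩
    · rintro ⟨h1, h2 | h2⟩
      · left
        have := List.prefix_of_prefix_length_le h2 (List.prefix_append (q ++ [b]) t) (by simp [h1])
        have := this.eq_of_length (by simp [h1])
        simpa using this
      · exact .inr ⟨h1, h2⟩

/-- The words `s` and `t` have the same prefix and suffix of length `n - 1` and the same factors
of length `n`. -/
structure SameTests (n : ℕ) (s t : List A) : Prop where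
  take_eq : s.take (n - 1) = t.take (n - 1)
  drop_eq : s.drop (s.length - (n - 1)) = t.drop (t.length - (n - 1))
  infix_iff : ∀ x : List A, x.length = n → (x <:+: s ↔ x <:+: t)

theorem SameTests.eq_of_length_lt {n : ℕ} {s t : List A} (h : SameTests n s t)
    (hs : s.length < n - 1) : s = t := by
  have h1 := h.take_eq
  rw [List.take_of_length_le hs.le] at h1
  have h2 : t.length < n - 1 := by
    have := congrArg List.length h1
    rw [List.length_take] at this
    omega
  rw [h1, List.take_of_length_le h2.le]

theorem SameTests.symm {n : ℕ} {s t : List A} (h : SameTests n s t) : SameTests n t s :=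
  ⟨h.take_eq.symm, h.drop_eq.symm, fun x hx => (h.infix_iff x hx).symm⟩

/-- A factor of length at most `T.length + 1` of `a ++ T ++ b` cannot start in `a` and end in
`b`. -/
theorem infix_append_append_iff {a T b x : List A} (hx : x.length ≤ T.length + 1) :
    x <:+: a ++ T ++ b ↔ x <:+: a ++ T ∨ x <:+: T ++ b := by
  constructor
  · rintro ⟨s, t, h⟩
    rcases le_or_gt a.length s.length with hs | hs
    · right
      have : a <+: s := List.prefix_of_prefix_length_le (l₃ := a ++ T ++ b)
        ⟨T ++ b, by simp⟩ ⟨x ++ t, by rw [← h]; simp⟩ hs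
      obtain ⟨s', rfl⟩ := this
      exact ⟨s', t, List.append_cancel_left (as := a) (by simpa using h)⟩
    · left
      have : s ++ x <+: a ++ T := List.prefix_of_prefix_length_le (l₃ := a ++ T ++ b)
        ⟨t, h⟩ ⟨b, rfl⟩ (by simp; omega)
      exact (List.infix_append' s x []).trans (by simpa using this.isInfix)
  · rintro (h | h)
    · exact h.trans ⟨[], b, by simp⟩
    · exact h.trans ⟨a, [], by simp⟩

/-- If two words begin with the same word of length at least `n - 1`, and end with the same such
word, then only the factors remain to be compared. -/
theorem sameTests_of_prefix_of_suffix {n : ℕ} {s t a b : List A} (ha : n - 1 ≤ a.length)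
    (hb : n - 1 ≤ b.length) (has : a <+: s) (hat : a <+: t) (hbs : b <:+ s) (hbt : b <:+ t)
    (h : ∀ x : List A, x.length = n → (x <:+: s ↔ x <:+: t)) : SameTests n s t := by
  refine ⟨?_, ?_, h⟩
  · obtain ⟨s', rfl⟩ := has
    obtain ⟨t', rfl⟩ := hat
    rw [List.take_append_of_le_length ha, List.take_append_of_le_length ha]
  · obtain ⟨s', rfl⟩ := hbs
    obtain ⟨t', rfl⟩ := hbt
    have (l : List A) : (l ++ b).drop ((l ++ b).length - (n - 1)) = b.drop (b.length - (n - 1)) := by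
      rw [List.length_append, Nat.add_sub_assoc hb, List.drop_append]
      simp
    rw [this, this]

/-- The two sides of `alpha`, with `W` for the period. -/
theorem sameTests_loop {n : ℕ} {T W V : List A} (hT : n - 1 ≤ T.length) (h : W ++ T = T ++ V) :
    SameTests n (W ++ T) (W ++ (W ++ T)) := by
  refine sameTests_of_prefix_of_suffix (a := W ++ T) (b := W ++ T) (by simp; omega)
    (by simp; omega) (List.prefix_refl _) ?_ (List.suffix_refl _) (List.suffix_append _ _)
    fun x hx => ?_
  · rw [h, ← List.append_assoc, h]; exact List.prefix_append _ _
  · conv_rhs => rw [h, ← List.append_assoc]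
    rw [infix_append_append_iff (by omega), ← h, or_self]

/-- The two sides of `beta`, with `T` for `x₁ ⋯ x_{n-1}`. -/
theorem sameTests_swap {n : ℕ} {T y z : List A} (hT : n - 1 ≤ T.length) :
    SameTests n (T ++ y ++ T ++ z ++ T) (T ++ z ++ T ++ y ++ T) := by
  refine sameTests_of_prefix_of_suffix hT hT ⟨y ++ T ++ z ++ T, by simp⟩
    ⟨z ++ T ++ y ++ T, by simp⟩ (List.suffix_append _ _) (List.suffix_append _ _) fun x hx => ?_
  have (y z : List A) : x <:+: T ++ y ++ T ++ z ++ T ↔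
      x <:+: T ++ y ++ T ∨ x <:+: T ++ z ++ T := by
    rw [List.append_assoc _ z T, infix_append_append_iff (by omega), List.append_assoc T z T]
  rw [this, this, or_comm]

end DeBruijn

/-! ### Values of words -/

section Values

variable {S : Type u} [Semigroup S]

/-- The product of a possibly empty word over `S`, in `S` with an identity adjoined. -/
def wprod (l : List S) : WithOne S := (l.map (WithOne.coe : S → WithOne S)).prod

theorem wprod_append (l l' : List S) : wprod (l ++ l') = wprod l * wprod l' := by
  simp [wprod]

theorem exists_coe_eq_wprod {l : List S} (hl : l ≠ []) : ∃ s : S, wprod l = s := by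
  induction l with
  | nil => exact absurd rfl hl
  | cons a l ih =>
    rcases eq_or_ne l [] with rfl | h
    · exact ⟨a, by simp [wprod]⟩
    · obtain ⟨s, hs⟩ := ih h
      exact ⟨a * s, by rw [WithOne.coe_mul, ← hs]; simp [wprod]⟩

theorem toFreeMonoid_eq_letters {A : Type u} (w : FreeSemigroup A) :
    FreeSemigroup.toFreeMonoid w = FreeMonoid.ofList (letters w) :=
  FreeSemigroup.toFreeMonoid_mk_eq_cons _ _

/-- The extension of a homomorphism on the free semigroup to the free monoid. -/
def extend {A : Type u} (φ : FreeSemigroup A →ₙ* S) : FreeMonoid A →* WithOne S :=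
  FreeMonoid.lift fun a => (φ (.of a) : WithOne S)

theorem extend_toFreeMonoid {A : Type u} (φ : FreeSemigroup A →ₙ* S) (w : FreeSemigroup A) :
    extend φ w.toFreeMonoid = (φ w : WithOne S) := by
  induction w using FreeSemigroup.recOnMul with
  | ih1 a => simp [extend]
  | ih2 a w ha hw => rw [map_mul, map_mul, map_mul, WithOne.coe_mul, hw, ← ha]

theorem coe_lift_id (w : FreeSemigroup S) :
    ((FreeSemigroup.lift (id : S → S) w : S) : WithOne S) = wprod (letters w) := by
  rw [← extend_toFreeMonoid, toFreeMonoid_eq_letters]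
  simp [extend, wprod, FreeMonoid.lift_apply]

theorem X_eq_mul {p r : ℕ} (h : p ≤ r) : ∃ R, X r = X p * R := by
  obtain ⟨c, rfl⟩ := Nat.exists_eq_add_of_le h
  refine ⟨FreeMonoid.ofList ((List.range c).map fun i => Var.x (p + i + 1)), ?_⟩
  simp [X, List.range_add, ← FreeMonoid.ofList_append, Function.comp_def]

theorem length_X (j : ℕ) : (X j).length = j := by simp [X, FreeMonoid.length]

theorem length_X_pow (r i : ℕ) : (X r ^ i).length = r * i := by
  induction i with
  | zero => simp
  | succ i ih => rw [pow_succ, FreeMonoid.length_mul, ih, length_X, mul_add_one]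

theorem alpha_eq (n r : ℕ) : alpha n r = (X r ^ ((n - 1) / r + 1) * X ((n - 1) % r),
    X r ^ ((n - 1) / r + 2) * X ((n - 1) % r)) := by
  have : (n - (n - 1) % r - 1) / r = (n - 1) / r := by
    rw [show n - (n - 1) % r - 1 = n - 1 - (n - 1) % r by omega, Nat.div_eq_sub_mod_div (m := n - 1)]
  simp only [alpha, this]

theorem alpha_ne_one {n r : ℕ} (hr : 1 ≤ r) : (alpha n r).1 ≠ 1 ∧ (alpha n r).2 ≠ 1 := by
  have (i : ℕ) (w : FreeMonoid Var) : X r ^ (i + 1) * w ≠ 1 := by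
    intro h
    have := congrArg FreeMonoid.length h
    rw [FreeMonoid.length_mul, length_X_pow, FreeMonoid.length_one, mul_add_one] at this
    omega
  rw [alpha_eq]
  exact ⟨this _ _, this _ _⟩

theorem beta_ne_one (n : ℕ) : (beta n).1 ≠ 1 ∧ (beta n).2 ≠ 1 := by simp [beta, Y]

theorem eval_X (f : Var → S) (j : ℕ) :
    eval f (X j) = wprod ((List.range j).map fun i => f (.x (i + 1))) := by
  simp [eval, X, wprod, FreeMonoid.lift_apply, Function.comp_def]

/-- A word `g` over `S` and elements `y`, `z` as values of the variables. -/
theorem exists_eval_X (g : List S) (y z : S) :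
    ∃ f : Var → S, f .y = y ∧ f .z = z ∧ ∀ j ≤ g.length, eval f (X j) = wprod (g.take j) := by
  refine ⟨fun v => match v with | .x i => g.getD (i - 1) y | .y => y | .z => z, rfl, rfl,
    fun j hj => ?_⟩
  rw [eval_X]
  congr 1
  apply List.ext_getElem
  · simp [hj]
  · intro i h1 h2
    have : i < g.length := by simp at h1; omega
    simp [this]

theorem wprod_of_holds_alpha {n r : ℕ} (h : Holds S (alpha n r)) (hr : 1 ≤ r) {g : List S}
    (hg : g.length = r) :
    wprod g ^ ((n - 1) / r + 1) * wprod (g.take ((n - 1) % r)) =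
      wprod g ^ ((n - 1) / r + 2) * wprod (g.take ((n - 1) % r)) := by
  have hne : g ≠ [] := by rintro rfl; simp at hg; omega
  obtain ⟨f, -, -, hf⟩ := exists_eval_X g (g.head hne) (g.head hne)
  have := h f
  simpa only [alpha_eq, map_mul, map_pow, hf _ hg.ge, hf _ ((Nat.mod_lt _ hr).le.trans hg.ge),
    List.take_of_length_le hg.le] using this

theorem wprod_of_holds_beta {n : ℕ} (h : Holds S (beta n)) {v : List S} (hv : v.length = n - 1)
    (y z : S) : wprod v * y * wprod v * z * wprod v = wprod v * z * wprod v * y * wprod v := by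
  obtain ⟨f, hy, hz, hf⟩ := exists_eval_X v y z
  have := h f
  have hY : eval f Y = y := by simp [eval, Y, hy]
  have hZ : eval f Z = z := by simp [eval, Z, hz]
  simpa only [beta, map_mul, hf _ hv.ge, List.take_of_length_le hv.le, hY, hZ] using this

/-! ### Loops under the identities -/

/-- If `v` is a prefix of `g ++ v`, then `v` is a prefix of a power of `g`. -/
theorem wprod_eq_of_append_eq {g : List S} (hg : g ≠ []) (v l : List S) (h : v ++ l = g ++ v) :
    wprod v = wprod g ^ (v.length / g.length) * wprod (g.take (v.length % g.length)) := by
  induction hN : v.length using Nat.strong_induction_on generalizing v with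
  | _ N ih =>
  have hpos : 0 < g.length := List.length_pos_iff.2 hg
  rcases lt_or_ge N g.length with hlt | hge
  · have hv : v <+: g := List.prefix_of_prefix_length_le (l₃ := v ++ l) (List.prefix_append _ _)
      (h ▸ List.prefix_append _ _) (by omega)
    rw [Nat.div_eq_of_lt hlt, Nat.mod_eq_of_lt hlt, ← hN, ← List.prefix_iff_eq_take.1 hv]
    simp
  · have hv : g <+: v := List.prefix_of_prefix_length_le (l₃ := v ++ l)
      (h ▸ List.prefix_append _ _) (List.prefix_append _ _) (by omega)
    obtain ⟨v', rfl⟩ := hv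
    have hlen : N = v'.length + g.length := by rw [← hN, List.length_append, add_comm]
    have := ih v'.length (by omega) v'
      (List.append_cancel_left (as := g) (by simpa using h)) rfl
    rw [wprod_append, this, hlen, Nat.add_div_right _ hpos, Nat.add_mod_right, pow_succ', mul_assoc]

/-- The identities `alpha` make loops of the de Bruijn graph idempotent. -/
theorem wprod_loop_idem {n : ℕ} (hn : 1 ≤ n)
    (hα : ∀ r, 1 ≤ r → r ≤ n → Holds S (alpha n r)) {v l g : List S} (hv : v.length = n - 1)
    (h : v ++ l = g ++ v) : wprod v * wprod l * wprod l = wprod v * wprod l := by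
  have hlen : g.length = l.length := by
    have := congrArg List.length h
    simp at this
    omega
  have hV : wprod v * wprod l = wprod g * wprod v := by rw [← wprod_append, h, wprod_append]
  rw [hV, mul_assoc, hV]
  rcases eq_or_ne g [] with rfl | hg
  · simp [wprod]
  have hpos : 0 < g.length := List.length_pos_iff.2 hg
  rcases le_or_gt g.length n with hr | hr
  · -- `g ++ v` has the period `g.length`, and is an instance of a side of `alpha`
    have := wprod_of_holds_alpha (hα g.length hpos hr) hpos rfl
    rw [wprod_eq_of_append_eq hg v l h, hv]
    simp only [pow_succ', mul_assoc] at this ⊢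
    exact this.symm
  · -- `g` begins with `v`, and the rest of `g` is the value of the last variable of `alpha n n`
    have hvg : v <+: g := List.prefix_of_prefix_length_le (l₃ := v ++ l) (List.prefix_append _ _)
      (h ▸ List.prefix_append _ _) (by omega)
    obtain ⟨y, rfl⟩ := hvg
    obtain ⟨s, hs⟩ := exists_coe_eq_wprod (l := y) (by rintro rfl; simp at hr; omega)
    have := wprod_of_holds_alpha (hα n hn le_rfl) hn (g := v ++ [s]) (by simp; omega)
    rw [Nat.div_eq_of_lt (by omega), Nat.mod_eq_of_lt (by omega), ← hv] at this
    have hvs : wprod (v ++ [s]) = wprod (v ++ y) := by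
      rw [wprod_append, wprod_append, hs]; simp [wprod]
    simpa [hvs, pow_two, mul_assoc] using this.symm

/-- Repeating a loop until it is longer than its base point `v` puts it into the form in which
loops occur in `beta`. -/
theorem exists_wprod_loop_eq {n : ℕ} (hn : 1 ≤ n)
    (hα : ∀ r, 1 ≤ r → r ≤ n → Holds S (alpha n r)) {v l g : List S} (hv : v.length = n - 1)
    (h : v ++ l = g ++ v) (hl : l ≠ []) : ∃ y : S, wprod v * wprod l = wprod v * y * wprod v := by
  have key : ∀ j, ∃ l' g', v ++ l' = g' ++ v ∧ j ≤ l'.length ∧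
      wprod v * wprod l' = wprod v * wprod l := by
    intro j
    induction j with
    | zero => exact ⟨l, g, h, Nat.zero_le _, rfl⟩
    | succ j ih =>
      obtain ⟨l', g', h1, h2, h3⟩ := ih
      refine ⟨l ++ l', g ++ g', ?_, ?_, ?_⟩
      · rw [← List.append_assoc, h, List.append_assoc, h1, List.append_assoc]
      · have := List.length_pos_iff.2 hl
        simp
        omega
      · rw [wprod_append, ← mul_assoc, ← wprod_append, h, wprod_append, mul_assoc, h3, ← mul_assoc,
          ← wprod_append, ← h, wprod_append, wprod_loop_idem hn hα hv h]
  obtain ⟨l', g', h1, h2, h3⟩ := key n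
  have : v <:+ l' := List.suffix_of_suffix_length_le (l₃ := v ++ l') (h1 ▸ List.suffix_append _ _)
    (List.suffix_append _ _) (by omega)
  obtain ⟨y, rfl⟩ := this
  obtain ⟨s, hs⟩ := exists_coe_eq_wprod (l := y) (by rintro rfl; simp at h2; omega)
  exact ⟨s, by rw [← h3, wprod_append, hs, mul_assoc]⟩

/-- The identities make consecutive loops of the de Bruijn graph commute. -/
theorem wprod_loop_comm {n : ℕ} (hn : 1 ≤ n)
    (hα : ∀ r, 1 ≤ r → r ≤ n → Holds S (alpha n r)) (hβ : Holds S (beta n))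
    {v l l' g g' : List S} (hv : v.length = n - 1) (h : v ++ l = g ++ v)
    (h' : v ++ l' = g' ++ v) :
    wprod v * wprod l * wprod l' = wprod v * wprod l' * wprod l := by
  rcases eq_or_ne l [] with rfl | hl
  · simp [wprod]
  rcases eq_or_ne l' [] with rfl | hl'
  · simp [wprod]
  obtain ⟨y, hy⟩ := exists_wprod_loop_eq hn hα hv h hl
  obtain ⟨z, hz⟩ := exists_wprod_loop_eq hn hα hv h' hl'
  have := wprod_of_holds_beta hβ hv y z
  rw [hy, hz, mul_assoc _ _ (wprod l'), hz, mul_assoc _ _ (wprod l), hy]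
  simpa only [mul_assoc] using this

/-- A path that reads `t` from the vertex `q` is the word `q ++ t`. -/
theorem loopSemilattice_wprod {n : ℕ} (hn : 1 ≤ n)
    (hα : ∀ r, 1 ≤ r → r ≤ n → Holds S (alpha n r)) (hβ : Holds S (beta n))
    {q : List S} (hq : q.length = n - 1) :
    LoopSemilattice shift q fun t => wprod (q ++ t) := by
  have hloop : ∀ {w l : List S}, (w ++ l).foldl shift q = w.foldl shift q →
      ∃ g, w.foldl shift q ++ l = g ++ w.foldl shift q := by
    intro w l h
    obtain ⟨g, hg⟩ := append_eq_append_foldl_shift (w.foldl shift q) l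
    rw [← List.foldl_append, h] at hg
    exact ⟨g, hg⟩
  constructor
  · intro w l r h
    obtain ⟨g, hg⟩ := append_eq_append_foldl_shift q w
    obtain ⟨g', hg'⟩ := hloop h
    have := wprod_loop_idem hn hα ((length_foldl_shift q w).trans hq) hg'
    simp only [← List.append_assoc, hg]
    simp only [wprod_append]
    simp only [mul_assoc] at this ⊢
    rw [← mul_assoc (wprod l), ← mul_assoc (wprod (w.foldl shift q)), this]
    simp only [mul_assoc]
  · intro w l l' r h h'
    obtain ⟨g, hg⟩ := append_eq_append_foldl_shift q w
    obtain ⟨g₁, hg₁⟩ := hloop h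
    obtain ⟨g₂, hg₂⟩ := hloop h'
    have := wprod_loop_comm hn hα hβ ((length_foldl_shift q w).trans hq) hg₁ hg₂
    simp only [← List.append_assoc, hg]
    simp only [wprod_append]
    simp only [mul_assoc] at this ⊢
    rw [← mul_assoc (wprod l), ← mul_assoc (wprod (w.foldl shift q)), this]
    simp only [mul_assoc]

theorem wprod_eq_of_sameTests {n : ℕ} (hn : 1 ≤ n)
    (hα : ∀ r, 1 ≤ r → r ≤ n → Holds S (alpha n r)) (hβ : Holds S (beta n))
    {s t : List S} (h : SameTests n s t) : wprod s = wprod t := by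
  rcases lt_or_ge s.length (n - 1) with hs | hs
  · rw [h.eq_of_length_lt hs]
  rcases lt_or_ge t.length (n - 1) with ht | ht
  · rw [h.symm.eq_of_length_lt ht]
  obtain ⟨q, s, rfl, hq⟩ : ∃ q s', s = q ++ s' ∧ q.length = n - 1 :=
    ⟨_, _, (List.take_append_drop (n - 1) s).symm, by simp [hs]⟩
  obtain ⟨q', t, rfl, hq'⟩ : ∃ q t', t = q ++ t' ∧ q.length = n - 1 :=
    ⟨_, _, (List.take_append_drop (n - 1) t).symm, by simp [ht]⟩
  have hqq : q = q' := by
    have := h.take_eq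
    rwa [← hq, List.take_left, hq, ← hq', List.take_left] at this
  subst hqq
  refine (loopSemilattice_wprod hn hα hβ hq).val_eq ?_ ?_
  · have := h.drop_eq
    rw [← hq] at this
    simpa [foldl_shift] using this
  · rintro ⟨p, a⟩
    rw [mem_edges_shift, mem_edges_shift]
    refine and_congr_right fun hp => h.infix_iff _ ?_
    simp
    omega

end Values

/-! ### The identities as a basis -/

section Basis

variable {S : Type u} [Semigroup S]

theorem mem_factors_iff {A : Type u} {n : ℕ} {w : FreeSemigroup A} {x : List A} :
    x ∈ factors n w ↔ x.length = n ∧ x <:+: letters w := by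
  simp [factors, List.IsInfix, eq_comm]

theorem sameTests_letters_iff {A : Type u} {n : ℕ} {v w : FreeSemigroup A} :
    SameTests n (letters v) (letters w) ↔ prefixOf (n - 1) v = prefixOf (n - 1) w ∧
      suffixOf (n - 1) v = suffixOf (n - 1) w ∧ factors n v = factors n w := by
  constructor
  · rintro ⟨h1, h2, h3⟩
    refine ⟨h1, h2, Set.ext fun x => ?_⟩
    rw [mem_factors_iff, mem_factors_iff]
    exact and_congr_right (h3 x)
  · rintro ⟨h1, h2, h3⟩
    refine ⟨h1, h2, fun x hx => ?_⟩
    have := Set.ext_iff.1 h3 x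
    rw [mem_factors_iff, mem_factors_iff] at this
    simpa [hx] using this

/-- The witness is the canonical surjection of the free semigroup on `S` itself. -/
theorem isTestable_of_holds_basis {n : ℕ} (hn : 1 ≤ n) (h : ∀ e ∈ basis n, Holds S e) :
    IsTestable n S := by
  refine ⟨S, FreeSemigroup.lift id, fun s => ⟨.of s, by simp⟩, fun v w h1 h2 h3 => ?_⟩
  rw [← WithOne.coe_inj, coe_lift_id, coe_lift_id]
  exact wprod_eq_of_sameTests hn (fun r h1 h2 => h _ (.inl ⟨r, h1, h2, rfl⟩)) (h _ (.inr rfl))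
    (sameTests_letters_iff.2 ⟨h1, h2, h3⟩)

/-- An identity holds in an `n`-testable semigroup if the substitutions of nonempty words for its
variables make its sides agree on all tests. -/
theorem IsTestable.holds {n : ℕ} (hS : IsTestable n S) {e : Identity} (h1 : e.1 ≠ 1)
    (h2 : e.2 ≠ 1)
    (h : ∀ (A : Type u) (g : Var → FreeSemigroup A),
      SameTests n (FreeMonoid.lift (fun v => (g v).toFreeMonoid) e.1).toList
        (FreeMonoid.lift (fun v => (g v).toFreeMonoid) e.2).toList) : Holds S e := by
  intro f
  obtain ⟨A, φ, hφ, htest⟩ := hS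
  choose g hg using fun v => hφ (f v)
  have hlift (w : FreeSemigroup Var) : FreeMonoid.lift (fun v => (g v).toFreeMonoid)
      w.toFreeMonoid = (FreeSemigroup.lift g w).toFreeMonoid := by
    induction w using FreeSemigroup.recOnMul with
    | ih1 v => simp
    | ih2 v w hv hw => rw [map_mul, map_mul, map_mul, map_mul, hw, ← hv]
  have hval (w : FreeSemigroup Var) : eval f w.toFreeMonoid =
      (φ (FreeSemigroup.lift g w) : WithOne S) := by
    rw [eval_toFreeMonoid]
    congr 1
    rw [← MulHom.comp_apply]
    congr 1
    apply FreeSemigroup.hom_ext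
    funext v
    simp [hg]
  have h := h A g
  obtain ⟨e₁, e₂⟩ := e
  obtain ⟨u, rfl⟩ := (FreeSemigroup.eq_one_or_toFreeMonoid e₁).resolve_left h1
  obtain ⟨v, rfl⟩ := (FreeSemigroup.eq_one_or_toFreeMonoid e₂).resolve_left h2
  dsimp only at h ⊢
  rw [hlift, hlift, toFreeMonoid_eq_letters, toFreeMonoid_eq_letters] at h
  obtain ⟨h1, h2, h3⟩ := sameTests_letters_iff.1 h
  rw [hval, hval, htest _ _ h1 h2 h3]

theorem le_length_lift {A : Type u} (g : Var → FreeSemigroup A) (w : FreeMonoid Var) :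
    w.length ≤ (FreeMonoid.lift (fun v => (g v).toFreeMonoid) w).length := by
  induction w with
  | one => simp
  | of v =>
    rw [FreeMonoid.lift_eval_of, toFreeMonoid_eq_letters]
    simp [letters, FreeMonoid.length]
  | mul v w hv hw =>
    simp only [FreeMonoid.length_mul, map_mul]
    omega

theorem IsTestable.holds_alpha {n r : ℕ} (hS : IsTestable n S) (hr : 1 ≤ r) :
    Holds S (alpha n r) := by
  refine hS.holds (alpha_ne_one hr).1 (alpha_ne_one hr).2 fun A g => ?_
  rw [alpha_eq]
  obtain ⟨R, hR⟩ := X_eq_mul (Nat.mod_lt (n - 1) hr).le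
  set σ := FreeMonoid.lift fun v => (g v).toFreeMonoid
  set T := X r ^ ((n - 1) / r) * X ((n - 1) % r) with hT
  have hTlen : n - 1 ≤ (σ T).length := by
    refine le_trans ?_ (le_length_lift g T)
    rw [hT, FreeMonoid.length_mul, length_X_pow, length_X, Nat.div_add_mod]
  -- the period `x₁ ⋯ x_r` moves past `T` in rotated form
  have hcomm : X r * T = T * (R * X ((n - 1) % r)) := by
    rw [hT, ← mul_assoc, ← pow_succ', pow_succ, mul_assoc, mul_assoc, ← mul_assoc (X _) R, ← hR]
  have h1 : X r ^ ((n - 1) / r + 1) * X ((n - 1) % r) = X r * T := by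
    rw [pow_succ', mul_assoc]
  have h2 : X r ^ ((n - 1) / r + 2) * X ((n - 1) % r) = X r * (X r * T) := by
    rw [pow_succ', mul_assoc, h1]
  rw [h1, h2]
  simp only [map_mul, FreeMonoid.toList_mul]
  refine sameTests_loop hTlen (V := (σ (R * X ((n - 1) % r))).toList) ?_
  rw [← FreeMonoid.toList_mul, ← FreeMonoid.toList_mul, ← map_mul, ← map_mul, hcomm]

theorem IsTestable.holds_beta {n : ℕ} (hS : IsTestable n S) : Holds S (beta n) := by
  refine hS.holds (beta_ne_one n).1 (beta_ne_one n).2 fun A g => ?_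
  simp only [beta, map_mul, FreeMonoid.toList_mul]
  exact sameTests_swap (((length_X (n - 1)).ge.trans (le_length_lift g _)))

theorem isBasisOfIdentities_basis {n : ℕ} (hn : 1 ≤ n) :
    IsBasisOfIdentities (basis n) (B.{u} n) := by
  refine fun S _ => ⟨fun hS e he => ?_, isTestable_of_holds_basis hn⟩
  rcases he with ⟨r, hr, -, rfl⟩ | rfl
  exacts [IsTestable.holds_alpha hS hr, IsTestable.holds_beta hS]

theorem holds_basis_one_iff :
    (∀ e ∈ basis 1, Holds S e) ↔ ∀ e ∈ semilatticeIdentities, Holds S e := by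
  have hX0 : X 0 = 1 := rfl
  have hX1 : X 1 = FreeMonoid.of (.x 1) := rfl
  have hα : Holds S (alpha 1 1) ↔ Holds S (Y ^ 2, Y) := by
    constructor <;> intro h f
    · simpa [alpha, hX0, hX1, eval, Y, eq_comm] using h fun _ => f .y
    · simpa [alpha, hX0, hX1, eval, Y, eq_comm] using h fun _ => f (.x 1)
  have hβ : beta 1 = (Y * Z, Z * Y) := by simp [beta, hX0]
  have hb : basis 1 = {alpha 1 1, beta 1} := by
    ext e
    constructor
    · rintro (⟨r, h1, h2, rfl⟩ | rfl)
      · obtain rfl := le_antisymm h2 h1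
        exact .inl rfl
      · exact .inr rfl
    · rintro (rfl | rfl)
      · exact .inl ⟨1, le_rfl, le_rfl, rfl⟩
      · exact .inr rfl
  simp [hb, semilatticeIdentities, hα, hβ]

end Basis

/-! ### Equational classes are varieties -/

section Variety

variable {S : Type u} [Semigroup S]

theorem holds_toFreeMonoid_iff {u v : FreeSemigroup Var} :
    Holds S (u.toFreeMonoid, v.toFreeMonoid) ↔
      ∀ f : Var → S, FreeSemigroup.lift f u = FreeSemigroup.lift f v := by
  simp only [Holds, eval_toFreeMonoid, WithOne.coe_inj]

theorem map_lift_freeSemigroup {T : Type u} [Semigroup T] (F : S →ₙ* T) (f : Var → S)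
    (w : FreeSemigroup Var) : F (FreeSemigroup.lift f w) = FreeSemigroup.lift (F ∘ f) w := by
  rw [← MulHom.comp_apply]
  congr 1
  apply FreeSemigroup.hom_ext
  funext v
  simp

/-- Both sides have to be nonempty: otherwise an identity can fail in the empty product. -/
theorem isVariety_of_isBasisOfIdentities {I : Set Identity} {C : SemigroupClass.{u}}
    (h : IsBasisOfIdentities I C) (hI : ∀ e ∈ I, e.1 ≠ 1 ∧ e.2 ≠ 1) : IsVariety C := by
  have key : ∀ (S : Type u) [Semigroup S], C S ↔ ∀ u v : FreeSemigroup Var,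
      (u.toFreeMonoid, v.toFreeMonoid) ∈ I →
        ∀ f : Var → S, FreeSemigroup.lift f u = FreeSemigroup.lift f v := by
    intro S _
    rw [h S]
    constructor
    · exact fun hS u v huv => holds_toFreeMonoid_iff.1 (hS _ huv)
    · rintro hS ⟨e₁, e₂⟩ he
      obtain ⟨u, rfl⟩ := (FreeSemigroup.eq_one_or_toFreeMonoid e₁).resolve_left (hI _ he).1
      obtain ⟨v, rfl⟩ := (FreeSemigroup.eq_one_or_toFreeMonoid e₂).resolve_left (hI _ he).2
      exact holds_toFreeMonoid_iff.2 (hS u v he)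
  refine ⟨?_, ?_, ?_⟩
  · intro S T _ _ F hF hS
    rw [key] at hS ⊢
    intro u v huv f
    choose g hg using fun x => hF (f x)
    obtain rfl : F ∘ g = f := funext hg
    rw [← map_lift_freeSemigroup, ← map_lift_freeSemigroup, hS u v huv]
  · intro S _ T hS
    rw [key] at hS ⊢
    intro u v huv f
    apply MulMemClass.subtype_injective T
    rw [map_lift_freeSemigroup, map_lift_freeSemigroup, hS u v huv]
  · intro ι S _ hS
    rw [key]
    intro u v huv f
    funext i
    have := (key _).1 (hS i) u v huv (Pi.evalMulHom S i ∘ f)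
    rwa [← map_lift_freeSemigroup, ← map_lift_freeSemigroup] at this

theorem isVariety_B {n : ℕ} (hn : 1 ≤ n) : IsVariety (B.{u} n) := by
  refine isVariety_of_isBasisOfIdentities (isBasisOfIdentities_basis hn) ?_
  rintro e (⟨r, hr, -, rfl⟩ | rfl)
  exacts [alpha_ne_one hr, beta_ne_one n]

end Variety

end TestableSemigroup

theorem theorem3p3 :
    (∀ n : ℕ, 1 ≤ n → TestableSemigroup.IsVariety (TestableSemigroup.B.{u} n)) ∧
    (∀ n : ℕ, 2 ≤ n → TestableSemigroup.IsBasisOfIdentities (TestableSemigroup.basis n)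
      (TestableSemigroup.B.{u} n)) ∧
    TestableSemigroup.IsBasisOfIdentities TestableSemigroup.semilatticeIdentities
      (TestableSemigroup.B.{u} 1) :=
  ⟨fun _ hn => TestableSemigroup.isVariety_B hn,
    fun _ hn => TestableSemigroup.isBasisOfIdentities_basis (one_le_two.trans hn),
    fun S _ => (TestableSemigroup.isBasisOfIdentities_basis le_rfl S).trans
      TestableSemigroup.holds_basis_one_iff⟩
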